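/- Theorem 3.1 (cohomology of $d$ in the space of invariant polynomials). Let $n\in\mathbb N$ be the spacetime dimension ($\mu,\nu,\dots$ take $n$ values) and let the internal index $a$ range over an arbitrary (finite or infinite) set. Consider the free graded-commutative real algebra $\Omega$ generated by * the commuting jet coordinates $\partial_{\mu_1\cdots\mu_s}h^a_{\alpha\beta}$ ($h^a_{\alpha\beta}=h^a_{\beta\alpha}$) and $\partial_{\mu_1\cdots\mu_s}C^{*\alpha}_a$, and * the mutually anticommuting jet coordinates $\partial_{\mu_1\cdots\mu_s}h^{*\alpha\beta}_a$ ($h^{*\alpha\beta}_a=h^{*\beta\alpha}_a$) and one-forms $dx^\mu$, where $s\ge 0$ and all jet coordinates are symmetric in the derivative indices. Let $\partial_\mu$ be the total derivative, i.e. the even derivation of $\Omega$ that adds one derivative index $\mu$ to each jet coordinate and kills $dx^\nu$, and let $d=dx^\mu\partial_\mu$. The form degree counts the $dx^\mu$; the antifield number gives weight $1$ to $h^*$, weight $2$ to $C^*$ (and to their derivatives the same weights), and weight $0$ to $h$, its derivatives and $dx^\mu$. Let $$K^a_{\alpha\beta\mu\nu}=-\tfrac12\left(\partial_{\alpha\mu}h^a_{\beta\nu}+\partial_{\beta\nu}h^a_{\alpha\mu}-\partial_{\alpha\nu}h^a_{\beta\mu}-\partial_{\beta\mu}h^a_{\alpha\nu}\right)$$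 be the linearized Riemann tensor. The invariant polynomials are the elements of the subalgebra of $\Omega$ generated by the $K^a_{\alpha\beta\mu\nu}$, $h^{*\alpha\beta}_a$, $C^{*\alpha}_a$, all their total derivatives of any order, and the $dx^\mu$. Then, in form degree less than $n$ and antifield number strictly greater than $0$, the cohomology of $d$ in the space of invariant polynomials is trivial: if $\alpha$ is an invariant polynomial, homogeneous of form degree $p<n$ and antifield number $k>0$, with $d\alpha=0$, then $\alpha=d\beta$ for an invariant polynomial $\beta$ that is homogeneous of form degree $p-1$ and antifield number $k$ (for $p=0$ this means $\alpha=0$). -/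

import Mathlib

open scoped TensorProduct

namespace SpinTwo

noncomputable section

/-- The commuting generators.  `h a s M` is the jet coordinate `∂_M h^a_{αβ}` of the spin-2 field,
where `s = {α, β}` is an unordered pair of spacetime indices (`h` is symmetric) and `M` is a
multi-index of derivatives; `cStar a α M` is the jet coordinate `∂_M C*_a^α` of the antifield of
antifield number two. -/
inductive EvenVar (n : ℕ) (I : Type*) where
  | h (a : I) (s : Sym2 (Fin n)) (M : Fin n →₀ ℕ)
  | cStar (a : I) (α : Fin n) (M : Fin n →₀ ℕ)

/-- The anticommuting generators.  `hStar a s M` is the jet coordinate `∂_M h*_a^{αβ}` of the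
(symmetric) antifield of antifield number one, `dx μ` is the one-form `dx^μ`. -/
inductive OddVar (n : ℕ) (I : Type*) where
  | hStar (a : I) (s : Sym2 (Fin n)) (M : Fin n →₀ ℕ)
  | dx (μ : Fin n)

/-- All generators, commuting and anticommuting. -/
abbrev Var (n : ℕ) (I : Type*) := EvenVar n I ⊕ OddVar n I

/-- The algebra of ghost-free, `x`-independent polynomial local forms: the free graded-commutative
real algebra on the commuting and the anticommuting generators. -/
abbrev LocalForm (n : ℕ) (I : Type*) :=
  MvPolynomial (EvenVar n I) ℝ ⊗[ℝ] ExteriorAlgebra ℝ (OddVar n I →₀ ℝ)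

variable {n : ℕ} {I : Type*}

/-- A generator as an element of the algebra of local forms. -/
def gen : Var n I → LocalForm n I
  | .inl v => MvPolynomial.X v ⊗ₜ[ℝ] 1
  | .inr w => 1 ⊗ₜ[ℝ] ExteriorAlgebra.ι ℝ (Finsupp.single w 1)

/-- The one-form `dx^μ`. -/
def dx (μ : Fin n) : LocalForm n I := gen (.inr (.dx μ))

/-- The even derivation of an exterior algebra that extends a linear endomorphism `T` of the space
of generators: `v₁ ∧ ⋯ ∧ vₖ ↦ ∑ᵢ v₁ ∧ ⋯ ∧ T vᵢ ∧ ⋯ ∧ vₖ`.  It is the `ε`-part of the algebra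
homomorphism `v ↦ v + ε T v` into the dual numbers. -/
def evenDerivation {V : Type*} [AddCommGroup V] [Module ℝ V] (T : V →ₗ[ℝ] V) :
    ExteriorAlgebra ℝ V →ₗ[ℝ] ExteriorAlgebra ℝ V :=
  (TrivSqZeroExt.sndHom (ExteriorAlgebra ℝ V) (ExteriorAlgebra ℝ V)).restrictScalars ℝ ∘ₗ
    (ExteriorAlgebra.lift ℝ
      (A := DualNumber (ExteriorAlgebra ℝ V))
      ⟨TrivSqZeroExt.inlAlgHom ℝ (ExteriorAlgebra ℝ V) (ExteriorAlgebra ℝ V) ∘ₗ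
            ExteriorAlgebra.ι ℝ
          + (TrivSqZeroExt.inrHom (ExteriorAlgebra ℝ V) (ExteriorAlgebra ℝ V)).restrictScalars ℝ ∘ₗ
            ExteriorAlgebra.ι ℝ ∘ₗ T, by
        intro v
        ext
        · simp
        · simp [ExteriorAlgebra.ι_add_mul_swap]⟩).toLinearMap

/-- The total derivative on commuting generators: `∂_M φ ↦ ∂_μ ∂_M φ`. -/
def EvenVar.shift (μ : Fin n) : EvenVar n I → EvenVar n I
  | .h a s M => .h a s (M + Finsupp.single μ 1)
  | .cStar a α M => .cStar a α (M + Finsupp.single μ 1)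

/-- The total derivative on anticommuting generators: `∂_M φ ↦ ∂_μ ∂_M φ`, and `dx^ν ↦ 0`. -/
def OddVar.shift (μ : Fin n) : OddVar n I → (OddVar n I →₀ ℝ)
  | .hStar a s M => Finsupp.single (.hStar a s (M + Finsupp.single μ 1)) 1
  | .dx _ => 0

/-- The total derivative `∂_μ` on local forms. -/
def totalDeriv (μ : Fin n) : LocalForm n I →ₗ[ℝ] LocalForm n I :=
  TensorProduct.map
      (MvPolynomial.mkDerivation ℝ
        (fun v : EvenVar n I => (MvPolynomial.X (v.shift μ) : MvPolynomial (EvenVar n I) ℝ)) :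
        MvPolynomial (EvenVar n I) ℝ →ₗ[ℝ] MvPolynomial (EvenVar n I) ℝ)
      LinearMap.id
    + TensorProduct.map LinearMap.id
      (evenDerivation (Finsupp.linearCombination ℝ (OddVar.shift (I := I) μ)))

/-- The (horizontal) exterior derivative `d = dx^μ ∂_μ` on local forms. -/
def extDeriv : LocalForm n I →ₗ[ℝ] LocalForm n I :=
  ∑ μ : Fin n, LinearMap.mulLeft ℝ (dx μ) ∘ₗ totalDeriv μ

/-- The second derivative `∂_ρ ∂_σ h^a_{κλ}`. -/
def ddh (a : I) (ρ σ κ l : Fin n) : LocalForm n I :=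
  gen (.inl (.h a s(κ, l) (Finsupp.single ρ 1 + Finsupp.single σ 1)))

/-- The linearized Riemann tensor
`K^a_{αβμν} = -½ (∂_{αμ} h_{βν} + ∂_{βν} h_{αμ} - ∂_{αν} h_{βμ} - ∂_{βμ} h_{αν})`. -/
def curvature (a : I) (α β μ ν : Fin n) : LocalForm n I :=
  (-(1 / 2) : ℝ) • (ddh a α μ β ν + ddh a β ν α μ - ddh a α ν β μ - ddh a β μ α ν)

/-- The linearized curvatures, the antifields, all their derivatives, and the `dx^μ`. -/
inductive IsInvariantGenerator : LocalForm n I → Prop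
  | curvature (a : I) (α β μ ν : Fin n) : IsInvariantGenerator (curvature a α β μ ν)
  | hStar (a : I) (α β : Fin n) : IsInvariantGenerator (gen (.inr (.hStar a s(α, β) 0)))
  | cStar (a : I) (α : Fin n) : IsInvariantGenerator (gen (.inl (.cStar a α 0)))
  | deriv (μ : Fin n) (x : LocalForm n I) :
      IsInvariantGenerator x → IsInvariantGenerator (totalDeriv μ x)
  | dx (μ : Fin n) : IsInvariantGenerator (dx μ)

/-- The algebra of invariant polynomials: polynomials in the linearized curvatures, the antifields
and all their derivatives, with values in exterior forms in the `dx^μ`. -/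
def invariantPolynomials (n : ℕ) (I : Type*) : Subalgebra ℝ (LocalForm n I) :=
  Algebra.adjoin ℝ {x | IsInvariantGenerator x}

/-- Form degree of a generator: one for `dx^μ`, zero for the fields and antifields. -/
def formDeg : Var n I → ℕ
  | .inr (.dx _) => 1
  | _ => 0

/-- Antifield number of a generator: one for `h*`, two for `C*`, zero for `h` and `dx^μ`. -/
def antifieldNum : Var n I → ℕ
  | .inr (.hStar _ _ _) => 1
  | .inl (.cStar _ _ _) => 2
  | _ => 0

/-- The local forms that are homogeneous of form degree `p` and antifield number `k`: the linear
combinations of monomials of that bidegree (only zero if `p` or `k` is negative). -/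
def bidegree (n : ℕ) (I : Type*) (p k : ℤ) : Submodule ℝ (LocalForm n I) :=
  Submodule.span ℝ
    {x | ∃ L : List (Var n I), ((L.map formDeg).sum : ℤ) = p ∧
      ((L.map antifieldNum).sum : ℤ) = k ∧ x = (L.map gen).prod}

end

end SpinTwo

/-! The antifields enter with all their derivatives freely, so a derivation `E_μ` (`lowerDeriv`) can
remove a derivative from them. It ignores `h` and `dx`. Weighting `E_μ` by antifield number gives
`[E_μ, D_ν] = k δ_{μν}` against the total derivatives `D_ν` on antifield number `k`
(`lowerDeriv_totalDeriv`), and `k > 0` makes this nondegenerate.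

Let `H = ∑ E_μ ∂/∂(dx^μ)` and `R = ∑ D_μ E_μ`. The Heisenberg relation and Euler's formula for the
form degree `p` give `dH + Hd = R + k (n - p)` (`extDeriv_homotopy_add`). The `E_μ` commute and are
locally nilpotent, so they define an exhaustive filtration. On its `m`-th layer `R` acts as `k m`
(`raiseLower_add_smul_mem`). For closed `x` in that layer, `dHx` is therefore `(k m + k (n - p)) x`
plus a closed term one step lower in the filtration. The scalar is positive because `p < n`, and
induction on the filtration finishes the argument.

All operators used preserve invariant polynomials. About the curvatures this needs only that they
and their derivatives are linear in the jets of `h`; no Bianchi identity enters. -/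

namespace SpinTwo

noncomputable section

variable {n : ℕ} {I : Type*}

/-! ### Even derivations of the exterior algebra and of local forms -/

section EvenDerivation

variable {V : Type*} [AddCommGroup V] [Module ℝ V]

/-- The algebra homomorphism `v ↦ v + ε T v` into the dual numbers whose `ε`-part is
`evenDerivation T`. -/
def dualLift (T : V →ₗ[ℝ] V) :
    ExteriorAlgebra ℝ V →ₐ[ℝ] DualNumber (ExteriorAlgebra ℝ V) :=
  ExteriorAlgebra.lift ℝ
      (A := DualNumber (ExteriorAlgebra ℝ V))
      ⟨TrivSqZeroExt.inlAlgHom ℝ (ExteriorAlgebra ℝ V) (ExteriorAlgebra ℝ V) ∘ₗ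
            ExteriorAlgebra.ι ℝ
          + (TrivSqZeroExt.inrHom (ExteriorAlgebra ℝ V) (ExteriorAlgebra ℝ V)).restrictScalars ℝ ∘ₗ
            ExteriorAlgebra.ι ℝ ∘ₗ T, by
        intro v
        ext
        · simp
        · simp [ExteriorAlgebra.ι_add_mul_swap]⟩

theorem evenDerivation_apply (T : V →ₗ[ℝ] V) (x : ExteriorAlgebra ℝ V) :
    evenDerivation T x = (dualLift T x).snd := rfl

theorem fst_dualLift (T : V →ₗ[ℝ] V) (x : ExteriorAlgebra ℝ V) : (dualLift T x).fst = x := by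
  have h : (TrivSqZeroExt.fstHom ℝ (ExteriorAlgebra ℝ V) (ExteriorAlgebra ℝ V)).comp (dualLift T)
      = AlgHom.id ℝ _ := by
    apply ExteriorAlgebra.hom_ext
    ext v
    simp [dualLift]
  exact DFunLike.congr_fun h x

theorem evenDerivation_ι (T : V →ₗ[ℝ] V) (v : V) :
    evenDerivation T (ExteriorAlgebra.ι ℝ v) = ExteriorAlgebra.ι ℝ (T v) := by
  simp [evenDerivation_apply, dualLift]

theorem evenDerivation_one (T : V →ₗ[ℝ] V) : evenDerivation T 1 = 0 := by
  simp [evenDerivation_apply]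

/-- The `ε`-part of a product of dual numbers is the Leibniz rule, once `fst_dualLift` identifies
the first components with `x` and `y`. -/
theorem evenDerivation_mul (T : V →ₗ[ℝ] V) (x y : ExteriorAlgebra ℝ V) :
    evenDerivation T (x * y) = evenDerivation T x * y + x * evenDerivation T y := by
  simp [evenDerivation_apply, fst_dualLift, add_comm]

end EvenDerivation

/-- The even derivation of the algebra of local forms with prescribed values on the generators. -/
def jetDerivation (f : EvenVar n I → MvPolynomial (EvenVar n I) ℝ)
    (g : OddVar n I → (OddVar n I →₀ ℝ)) : LocalForm n I →ₗ[ℝ] LocalForm n I :=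
  TensorProduct.map
      (MvPolynomial.mkDerivation ℝ f : MvPolynomial (EvenVar n I) ℝ →ₗ[ℝ] MvPolynomial (EvenVar n I) ℝ)
      LinearMap.id
    + TensorProduct.map LinearMap.id
      (evenDerivation (Finsupp.linearCombination ℝ g))

theorem totalDeriv_eq (μ : Fin n) :
    totalDeriv (I := I) μ = jetDerivation (fun v => MvPolynomial.X (v.shift μ)) (OddVar.shift μ) :=
  rfl

section JetDerivation

variable (f : EvenVar n I → MvPolynomial (EvenVar n I) ℝ) (g : OddVar n I → (OddVar n I →₀ ℝ))

theorem jetDerivation_tmul (a : MvPolynomial (EvenVar n I) ℝ)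
    (b : ExteriorAlgebra ℝ (OddVar n I →₀ ℝ)) :
    jetDerivation f g (a ⊗ₜ b) = MvPolynomial.mkDerivation ℝ f a ⊗ₜ b +
      a ⊗ₜ evenDerivation (Finsupp.linearCombination ℝ g) b := by
  simp [jetDerivation]

theorem jetDerivation_mul (x y : LocalForm n I) :
    jetDerivation f g (x * y) = jetDerivation f g x * y + x * jetDerivation f g y := by
  induction x using TensorProduct.induction_on with
  | zero => simp
  | add x x' hx hx' => simp only [add_mul, map_add, hx, hx']; abel
  | tmul a b =>
    induction y using TensorProduct.induction_on with
    | zero => simp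
    | add y y' hy hy' => simp only [mul_add, map_add, hy, hy']; abel
    | tmul a' b' =>
      simp only [Algebra.TensorProduct.tmul_mul_tmul, jetDerivation_tmul, evenDerivation_mul,
        Derivation.leibniz, add_mul, mul_add, TensorProduct.add_tmul, TensorProduct.tmul_add,
        smul_eq_mul, mul_comm a']
      abel

theorem jetDerivation_one : jetDerivation f g (1 : LocalForm n I) = 0 := by
  rw [Algebra.TensorProduct.one_def, jetDerivation_tmul, evenDerivation_one]
  simp

theorem jetDerivation_gen_inl (v : EvenVar n I) :
    jetDerivation f g (gen (.inl v)) = f v ⊗ₜ 1 := by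
  rw [gen, jetDerivation_tmul, evenDerivation_one]
  simp

theorem jetDerivation_gen_inr (w : OddVar n I) :
    jetDerivation f g (gen (.inr w)) = 1 ⊗ₜ ExteriorAlgebra.ι ℝ (g w) := by
  rw [gen, jetDerivation_tmul, evenDerivation_ι]
  simp

end JetDerivation

/-! ### The lowering derivations -/

/-- The value on a commuting generator of the derivation lowering the number of derivatives. -/
def EvenVar.lower (μ : Fin n) : EvenVar n I → MvPolynomial (EvenVar n I) ℝ
  | .h _ _ _ => 0
  | .cStar a α M => (2 * M μ : ℝ) • MvPolynomial.X (.cStar a α (M - Finsupp.single μ 1))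

/-- The value on an anticommuting generator of the derivation lowering the number of derivatives. -/
def OddVar.lower (μ : Fin n) : OddVar n I → (OddVar n I →₀ ℝ)
  | .hStar a s M => (M μ : ℝ) • Finsupp.single (.hStar a s (M - Finsupp.single μ 1)) 1
  | .dx _ => 0

/-- The derivation that removes a derivative `∂_μ` from the antifields, weighted by antifield
number.  It forms Heisenberg pairs with the total derivatives. -/
def lowerDeriv (μ : Fin n) : LocalForm n I →ₗ[ℝ] LocalForm n I :=
  jetDerivation (EvenVar.lower μ) (OddVar.lower μ)

theorem totalDeriv_mul (μ : Fin n) (x y : LocalForm n I) :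
    totalDeriv μ (x * y) = totalDeriv μ x * y + x * totalDeriv μ y :=
  jetDerivation_mul _ _ x y

theorem totalDeriv_one (μ : Fin n) : totalDeriv μ (1 : LocalForm n I) = 0 := jetDerivation_one _ _

theorem lowerDeriv_mul (μ : Fin n) (x y : LocalForm n I) :
    lowerDeriv μ (x * y) = lowerDeriv μ x * y + x * lowerDeriv μ y :=
  jetDerivation_mul _ _ x y

theorem lowerDeriv_one (μ : Fin n) : lowerDeriv μ (1 : LocalForm n I) = 0 := jetDerivation_one _ _

@[simp] theorem totalDeriv_gen_inl (μ : Fin n) (v : EvenVar n I) :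
    totalDeriv μ (gen (.inl v)) = gen (.inl (v.shift μ)) :=
  jetDerivation_gen_inl _ _ v

@[simp] theorem totalDeriv_hStar (μ : Fin n) (a : I) (s : Sym2 (Fin n)) (M : Fin n →₀ ℕ) :
    totalDeriv μ (gen (.inr (.hStar a s M))) =
      gen (.inr (.hStar a s (M + Finsupp.single μ 1))) :=
  jetDerivation_gen_inr _ _ _

@[simp] theorem totalDeriv_dx (μ ν : Fin n) :
    totalDeriv μ (gen (.inr (.dx ν)) : LocalForm n I) = 0 := by
  rw [totalDeriv_eq, jetDerivation_gen_inr]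
  simp [OddVar.shift]

@[simp] theorem lowerDeriv_h (μ : Fin n) (a : I) (s : Sym2 (Fin n)) (M : Fin n →₀ ℕ) :
    lowerDeriv μ (gen (.inl (.h a s M))) = 0 := by
  rw [lowerDeriv, jetDerivation_gen_inl]
  simp [EvenVar.lower]

@[simp] theorem lowerDeriv_cStar (μ : Fin n) (a : I) (α : Fin n) (M : Fin n →₀ ℕ) :
    lowerDeriv μ (gen (.inl (.cStar a α M))) =
      (2 * M μ : ℝ) • gen (.inl (.cStar a α (M - Finsupp.single μ 1))) := by
  rw [lowerDeriv, jetDerivation_gen_inl, EvenVar.lower, ← TensorProduct.smul_tmul']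
  rfl

@[simp] theorem lowerDeriv_hStar (μ : Fin n) (a : I) (s : Sym2 (Fin n)) (M : Fin n →₀ ℕ) :
    lowerDeriv μ (gen (.inr (.hStar a s M))) =
      (M μ : ℝ) • gen (.inr (.hStar a s (M - Finsupp.single μ 1))) := by
  rw [lowerDeriv, jetDerivation_gen_inr, OddVar.lower, map_smul, TensorProduct.tmul_smul]
  rfl

@[simp] theorem lowerDeriv_dx (μ ν : Fin n) :
    lowerDeriv μ (gen (.inr (.dx ν)) : LocalForm n I) = 0 := by
  rw [lowerDeriv, jetDerivation_gen_inr]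
  simp [OddVar.lower]

/-! ### Contraction with the one-forms -/

/-- The coefficient of `dx^μ`, as a linear form on the space of anticommuting generators. -/
def dxCoeff (μ : Fin n) : Module.Dual ℝ (OddVar n I →₀ ℝ) := Finsupp.lapply (.dx μ)

/-- The contraction `∂/∂(dx^μ)`. -/
def contraction (μ : Fin n) : LocalForm n I →ₗ[ℝ] LocalForm n I :=
  TensorProduct.map LinearMap.id
    (CliffordAlgebra.contractLeft (Q := (0 : QuadraticForm ℝ (OddVar n I →₀ ℝ))) (dxCoeff μ))

theorem contraction_tmul (μ : Fin n) (a : MvPolynomial (EvenVar n I) ℝ)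
    (b : ExteriorAlgebra ℝ (OddVar n I →₀ ℝ)) :
    contraction μ (a ⊗ₜ[ℝ] b) = a ⊗ₜ[ℝ] CliffordAlgebra.contractLeft
      (Q := (0 : QuadraticForm ℝ (OddVar n I →₀ ℝ))) (dxCoeff μ) b := by
  simp [contraction]

theorem contraction_one (μ : Fin n) : contraction μ (1 : LocalForm n I) = 0 := by
  rw [Algebra.TensorProduct.one_def, contraction_tmul]
  have := CliffordAlgebra.contractLeft_one (Q := (0 : QuadraticForm ℝ (OddVar n I →₀ ℝ)))
    (dxCoeff μ)
  erw [this]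
  simp

theorem contraction_even_mul (μ : Fin n) (a : MvPolynomial (EvenVar n I) ℝ) (y : LocalForm n I) :
    contraction μ (a ⊗ₜ[ℝ] 1 * y) = a ⊗ₜ[ℝ] 1 * contraction μ y := by
  induction y using TensorProduct.induction_on with
  | zero => simp
  | add x y hx hy => simp only [mul_add, map_add, hx, hy]
  | tmul b c => simp [contraction_tmul]

theorem contraction_odd_mul (μ : Fin n) (v : OddVar n I →₀ ℝ) (y : LocalForm n I) :
    contraction μ (1 ⊗ₜ[ℝ] ExteriorAlgebra.ι ℝ v * y) =
      dxCoeff μ v • y - 1 ⊗ₜ[ℝ] ExteriorAlgebra.ι ℝ v * contraction μ y := by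
  induction y using TensorProduct.induction_on with
  | zero => simp
  | add x y hx hy => simp only [mul_add, map_add, hx, hy, smul_add]; abel
  | tmul b c =>
    have := CliffordAlgebra.contractLeft_ι_mul (Q := (0 : QuadraticForm ℝ (OddVar n I →₀ ℝ)))
      (d := dxCoeff μ) v c
    rw [Algebra.TensorProduct.tmul_mul_tmul, contraction_tmul, contraction_tmul,
      Algebra.TensorProduct.tmul_mul_tmul]
    erw [this]
    rw [TensorProduct.tmul_sub, one_mul, TensorProduct.tmul_smul]

theorem contraction_inl_mul (μ : Fin n) (v : EvenVar n I) (y : LocalForm n I) :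
    contraction μ (gen (.inl v) * y) = gen (.inl v) * contraction μ y :=
  contraction_even_mul μ _ y

theorem contraction_hStar_mul (μ : Fin n) (a : I) (s : Sym2 (Fin n)) (M : Fin n →₀ ℕ)
    (y : LocalForm n I) :
    contraction μ (gen (.inr (.hStar a s M)) * y) =
      -(gen (.inr (.hStar a s M)) * contraction μ y) := by
  simp [gen, contraction_odd_mul, dxCoeff]

theorem contraction_dx_mul (μ ν : Fin n) (y : LocalForm n I) :
    contraction μ (gen (.inr (.dx ν)) * y) =
      (if μ = ν then y else 0) - gen (.inr (.dx ν)) * contraction μ y := by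
  have h : dxCoeff (I := I) μ (Finsupp.single (.dx ν) 1) = if μ = ν then 1 else 0 := by
    by_cases h : μ = ν
    · simp [dxCoeff, h]
    · rw [if_neg h, dxCoeff, Finsupp.lapply_apply,
        Finsupp.single_eq_of_ne fun e => h (OddVar.dx.inj e)]
  rw [gen, contraction_odd_mul, h]
  split_ifs <;> simp

theorem inl_mul_comm (v : EvenVar n I) (y : LocalForm n I) :
    gen (.inl v) * y = y * gen (.inl v) := by
  induction y using TensorProduct.induction_on with
  | zero => simp
  | add x y hx hy => simp only [mul_add, add_mul, hx, hy]
  | tmul b c => simp [gen, mul_comm]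

theorem inr_mul_inr (v w : OddVar n I) :
    (gen (.inr v) : LocalForm n I) * gen (.inr w) = -(gen (.inr w) * gen (.inr v)) := by
  simp only [gen, Algebra.TensorProduct.tmul_mul_tmul, mul_one, ← TensorProduct.tmul_neg]
  rw [eq_neg_of_add_eq_zero_left (ExteriorAlgebra.ι_add_mul_swap _ _)]

/-- The generators generate the algebra of local forms. -/
theorem localForm_induction {P : LocalForm n I → Prop} (one : P 1)
    (add : ∀ x y, P x → P y → P (x + y)) (smul : ∀ (c : ℝ) x, P x → P (c • x))
    (gen_mul : ∀ v x, P x → P (gen v * x)) (x : LocalForm n I) : P x := by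
  have odd : ∀ b : ExteriorAlgebra ℝ (OddVar n I →₀ ℝ), P (1 ⊗ₜ b) := by
    intro b
    induction b using CliffordAlgebra.left_induction with
    | algebraMap r =>
      have := smul r 1 one
      rwa [Algebra.TensorProduct.one_def, ← TensorProduct.tmul_smul,
        ← Algebra.algebraMap_eq_smul_one] at this
    | add x y hx hy => rw [TensorProduct.tmul_add]; exact add _ _ hx hy
    | ι_mul x m hx =>
      induction m using Finsupp.induction_linear with
      | zero =>
        have := smul 0 1 one
        simpa using this
      | add f g hf hg =>
        rw [map_add, add_mul, TensorProduct.tmul_add]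
        exact add _ _ hf hg
      | single v r =>
        have := smul r _ (gen_mul (.inr v) _ hx)
        rw [gen, Algebra.TensorProduct.tmul_mul_tmul, ← TensorProduct.tmul_smul,
          ← smul_mul_assoc, ← map_smul, Finsupp.smul_single, smul_eq_mul, mul_one, mul_one] at this
        exact this
  induction x using TensorProduct.induction_on with
  | zero =>
    have := smul 0 1 one
    simpa using this
  | add x y hx hy => exact add _ _ hx hy
  | tmul a b =>
    induction a using MvPolynomial.induction_on with
    | C r =>
      have := smul r _ (odd b)
      rwa [TensorProduct.smul_tmul', ← MvPolynomial.C_eq_smul_one] at this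
    | add p q hp hq => rw [TensorProduct.add_tmul]; exact add _ _ hp hq
    | mul_X p v hp =>
      have := gen_mul (.inl v) _ hp
      rwa [gen, Algebra.TensorProduct.tmul_mul_tmul, one_mul, mul_comm] at this

/-! ### Commutation relations -/

theorem totalDeriv_gen (μ : Fin n) (v : Var n I) :
    ∃ (c : ℝ) (w : Var n I), formDeg w = formDeg v ∧ antifieldNum w = antifieldNum v ∧
      totalDeriv μ (gen v) = c • gen w := by
  rcases v with (⟨a, s, M⟩ | ⟨a, α, M⟩) | (⟨a, s, M⟩ | ν)
  · exact ⟨1, .inl (EvenVar.shift μ (.h a s M)), rfl, rfl, by simp⟩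
  · exact ⟨1, .inl (EvenVar.shift μ (.cStar a α M)), rfl, rfl, by simp⟩
  · exact ⟨1, .inr (.hStar a s (M + Finsupp.single μ 1)), rfl, rfl, by simp⟩
  · exact ⟨0, .inr (.dx ν), rfl, rfl, by simp⟩

theorem lowerDeriv_gen (μ : Fin n) (v : Var n I) :
    ∃ (c : ℝ) (w : Var n I), formDeg w = formDeg v ∧ antifieldNum w = antifieldNum v ∧
      lowerDeriv μ (gen v) = c • gen w := by
  rcases v with (⟨a, s, M⟩ | ⟨a, α, M⟩) | (⟨a, s, M⟩ | ν)
  · exact ⟨0, .inl (.h a s M), rfl, rfl, by simp⟩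
  · exact ⟨_, .inl (.cStar a α (M - Finsupp.single μ 1)), rfl, rfl, lowerDeriv_cStar ..⟩
  · exact ⟨_, .inr (.hStar a s (M - Finsupp.single μ 1)), rfl, rfl, lowerDeriv_hStar ..⟩
  · exact ⟨0, .inr (.dx ν), rfl, rfl, by simp⟩

theorem totalDeriv_comm (μ ν : Fin n) (x : LocalForm n I) :
    totalDeriv μ (totalDeriv ν x) = totalDeriv ν (totalDeriv μ x) := by
  induction x using localForm_induction with
  | one => simp [totalDeriv_one]
  | add x y hx hy => simp [hx, hy]
  | smul c x hx => simp [hx]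
  | gen_mul v x hx =>
    have h : totalDeriv μ (totalDeriv ν (gen v)) = totalDeriv ν (totalDeriv μ (gen v)) := by
      rcases v with (⟨a, s, M⟩ | ⟨a, α, M⟩) | (⟨a, s, M⟩ | ν) <;>
        simp [EvenVar.shift, add_right_comm]
    simp only [totalDeriv_mul, map_add, hx, h]
    abel

theorem lowerDeriv_comm (μ ν : Fin n) (x : LocalForm n I) :
    lowerDeriv μ (lowerDeriv ν x) = lowerDeriv ν (lowerDeriv μ x) := by
  rcases eq_or_ne μ ν with rfl | hne
  · rfl
  induction x using localForm_induction with
  | one => simp [lowerDeriv_one]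
  | add x y hx hy => simp [hx, hy]
  | smul c x hx => simp [hx]
  | gen_mul v x hx =>
    have h : lowerDeriv μ (lowerDeriv ν (gen v)) = lowerDeriv ν (lowerDeriv μ (gen v)) := by
      rcases v with (⟨a, s, M⟩ | ⟨a, α, M⟩) | (⟨a, s, M⟩ | ρ)
      · simp
      · simp [hne, hne.symm, smul_smul, tsub_right_comm (a := M) (b := Finsupp.single μ 1), mul_comm]
      · simp [hne, hne.symm, smul_smul, tsub_right_comm (a := M) (b := Finsupp.single μ 1), mul_comm]
      · simp
    simp only [lowerDeriv_mul, map_add, hx, h]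
    abel

theorem contraction_totalDeriv (μ ν : Fin n) (x : LocalForm n I) :
    contraction μ (totalDeriv ν x) = totalDeriv ν (contraction μ x) := by
  induction x using localForm_induction with
  | one => simp [totalDeriv_one, contraction_one]
  | add x y hx hy => simp [hx, hy]
  | smul c x hx => simp [hx]
  | gen_mul v x hx =>
    rcases v with v | (⟨a, s, M⟩ | ν)
    · simp only [totalDeriv_mul, totalDeriv_gen_inl, map_add, contraction_inl_mul, hx]
    · rw [totalDeriv_mul, map_add, totalDeriv_hStar, contraction_hStar_mul, contraction_hStar_mul,
        hx, contraction_hStar_mul, map_neg, totalDeriv_mul, totalDeriv_hStar, neg_add]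
    · simp only [totalDeriv_mul, totalDeriv_dx, zero_mul, zero_add, contraction_dx_mul, map_sub, hx]
      split_ifs <;> simp

/-- Commutation relation on generators. -/
theorem lowerDeriv_totalDeriv_gen (μ ν : Fin n) (v : Var n I) :
    lowerDeriv μ (totalDeriv ν (gen v)) = totalDeriv ν (lowerDeriv μ (gen v)) +
      (if μ = ν then (antifieldNum v : ℝ) else 0) • gen v := by
  -- Subtraction of multi-indices is truncated. It fails to commute with adding a derivative only if
  -- `μ = ν` and `M μ = 0`, and then the coefficient `M μ` removes the term.
  have key : ∀ M : Fin n →₀ ℕ, M μ = 0 ∧ μ ≠ ν ∨ M μ = 0 ∧ μ = ν ∨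
      M + Finsupp.single ν 1 - Finsupp.single μ 1 = M - Finsupp.single μ 1 + Finsupp.single ν 1 := by
    intro M
    by_cases h : M μ = 0
    · tauto
    · refine .inr (.inr ?_)
      ext i
      by_cases hi : μ = i
      · subst hi
        simp only [Finsupp.coe_tsub, Finsupp.coe_add, Pi.sub_apply, Pi.add_apply,
          Finsupp.single_eq_same]
        omega
      · simp [Finsupp.single_apply, hi]
  have shift : ∀ M : Fin n →₀ ℕ, M μ ≠ 0 →
      M - Finsupp.single μ 1 + Finsupp.single μ 1 = M := fun M h =>
    tsub_add_cancel_of_le (by simpa [Nat.one_le_iff_ne_zero] using h)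
  rcases v with (⟨a, s, M⟩ | ⟨a, α, M⟩) | (⟨a, s, M⟩ | ρ)
  · simp [EvenVar.shift, antifieldNum]
  · rcases eq_or_ne μ ν with rfl | hne
    · by_cases h0 : M μ = 0
      · simp [EvenVar.shift, antifieldNum, h0]
      · simp [EvenVar.shift, antifieldNum, shift M h0, mul_add, add_smul]
    · rcases key M with ⟨h0, -⟩ | ⟨-, h⟩ | h
      · simp [EvenVar.shift, h0, hne]
      · exact absurd h hne
      · simp [EvenVar.shift, hne, h]
  · rcases eq_or_ne μ ν with rfl | hne
    · by_cases h0 : M μ = 0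
      · simp [antifieldNum, h0]
      · simp [antifieldNum, shift M h0, add_smul]
    · rcases key M with ⟨h0, -⟩ | ⟨-, h⟩ | h
      · simp [h0, hne]
      · exact absurd h hne
      · simp [hne, h]
  · simp [antifieldNum]

/-! ### Bidegree -/

theorem one_mem_bidegree : (1 : LocalForm n I) ∈ bidegree n I 0 0 :=
  Submodule.subset_span ⟨[], by simp⟩

theorem gen_mul_mem_bidegree (v : Var n I) {p k : ℤ} {x : LocalForm n I}
    (hx : x ∈ bidegree n I p k) :
    gen v * x ∈ bidegree n I (p + formDeg v) (k + antifieldNum v) := by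
  induction hx using Submodule.span_induction with
  | mem x h =>
    obtain ⟨L, hp, hk, rfl⟩ := h
    exact Submodule.subset_span ⟨v :: L, by simp [hp, add_comm], by simp [hk, add_comm], by simp⟩
  | zero => simp
  | add x y _ _ hx hy => rw [mul_add]; exact add_mem hx hy
  | smul c x _ hx => rw [mul_smul_comm]; exact Submodule.smul_mem _ _ hx

/-- The bidegree varies inside the motive because each generator shifts it; identities whose scalars
depend on `p` or `k` can then be proved generator by generator. -/
theorem bidegree_induction {P : ∀ (p k : ℤ) (x : LocalForm n I), x ∈ bidegree n I p k → Prop}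
    (zero : ∀ p k, P p k 0 (zero_mem _))
    (one : P 0 0 1 one_mem_bidegree)
    (add : ∀ p k x y hx hy, P p k x hx → P p k y hy → P p k (x + y) (add_mem hx hy))
    (smul : ∀ p k (c : ℝ) x hx, P p k x hx → P p k (c • x) (Submodule.smul_mem _ c hx))
    (gen_mul : ∀ v p k x hx, P p k x hx →
      P (p + formDeg v) (k + antifieldNum v) (gen v * x) (gen_mul_mem_bidegree v hx))
    {p k : ℤ} {x : LocalForm n I} (hx : x ∈ bidegree n I p k) : P p k x hx := by
  have list : ∀ (L : List (Var n I)) (p k : ℤ), ((L.map formDeg).sum : ℤ) = p →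
      ((L.map antifieldNum).sum : ℤ) = k → ∃ h, P p k (L.map gen).prod h := by
    intro L
    induction L with
    | nil =>
      rintro p k rfl rfl
      exact ⟨by simpa using one_mem_bidegree, by simpa using one⟩
    | cons v L ih =>
      intro p k hp hk
      obtain ⟨h, hP⟩ := ih (p - formDeg v) (k - antifieldNum v) (by rw [← hp]; simp)
        (by rw [← hk]; simp)
      have := gen_mul v _ _ _ h hP
      rw [List.map_cons, List.prod_cons]
      simp only [sub_add_cancel] at this
      exact ⟨_, this⟩
  induction hx using Submodule.span_induction with
  | mem x h =>
    obtain ⟨L, hp, hk, rfl⟩ := h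
    exact (list L p k hp hk).2
  | zero => exact zero p k
  | add x y _ _ hx hy => exact add p k x y _ _ hx hy
  | smul c x _ hx => exact smul p k c x _ hx

theorem derivation_mem_bidegree {T : LocalForm n I →ₗ[ℝ] LocalForm n I} (one : T 1 = 0)
    (mul : ∀ x y, T (x * y) = T x * y + x * T y)
    (gen' : ∀ v, ∃ (c : ℝ) (w : Var n I), formDeg w = formDeg v ∧
      antifieldNum w = antifieldNum v ∧ T (gen v) = c • gen w)
    {p k : ℤ} {x : LocalForm n I} (hx : x ∈ bidegree n I p k) : T x ∈ bidegree n I p k := by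
  induction hx using bidegree_induction with
  | zero p k => simp
  | one => simp [one]
  | add p k x y _ _ hx hy => rw [map_add]; exact add_mem hx hy
  | smul p k c x _ hx => rw [map_smul]; exact Submodule.smul_mem _ _ hx
  | gen_mul v p k x hx hT =>
    obtain ⟨c, w, hw, hw', h⟩ := gen' v
    rw [mul, h, smul_mul_assoc]
    refine add_mem (Submodule.smul_mem _ _ ?_) (gen_mul_mem_bidegree v hT)
    rw [← hw, ← hw']
    exact gen_mul_mem_bidegree w hx

theorem totalDeriv_mem_bidegree (μ : Fin n) {p k : ℤ} {x : LocalForm n I}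
    (hx : x ∈ bidegree n I p k) : totalDeriv μ x ∈ bidegree n I p k :=
  derivation_mem_bidegree (totalDeriv_one μ) (totalDeriv_mul μ) (totalDeriv_gen μ) hx

theorem lowerDeriv_mem_bidegree (μ : Fin n) {p k : ℤ} {x : LocalForm n I}
    (hx : x ∈ bidegree n I p k) : lowerDeriv μ x ∈ bidegree n I p k :=
  derivation_mem_bidegree (lowerDeriv_one μ) (lowerDeriv_mul μ) (lowerDeriv_gen μ) hx

theorem contraction_mem_bidegree (μ : Fin n) {p k : ℤ} {x : LocalForm n I}
    (hx : x ∈ bidegree n I p k) : contraction μ x ∈ bidegree n I (p - 1) k := by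
  induction hx using bidegree_induction with
  | zero p k => simp
  | one => simp [contraction_one]
  | add p k x y _ _ hx hy => rw [map_add]; exact add_mem hx hy
  | smul p k c x _ hx => rw [map_smul]; exact Submodule.smul_mem _ _ hx
  | gen_mul v p k x hx h =>
    have hv := gen_mul_mem_bidegree v h
    rw [sub_add_eq_add_sub] at hv
    rcases v with v | (⟨a, s, M⟩ | ν)
    · rwa [contraction_inl_mul]
    · rw [contraction_hStar_mul]
      exact neg_mem hv
    · rw [contraction_dx_mul]
      refine sub_mem ?_ hv
      split_ifs
      · simpa [formDeg, antifieldNum] using hx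
      · exact zero_mem _

/-- On antifield number `k`, the lowering and the total derivatives satisfy the Heisenberg
commutation relations with central element `k`. -/
theorem lowerDeriv_totalDeriv (μ ν : Fin n) {p k : ℤ} {x : LocalForm n I}
    (hx : x ∈ bidegree n I p k) :
    lowerDeriv μ (totalDeriv ν x) = totalDeriv ν (lowerDeriv μ x) +
      (if μ = ν then (k : ℝ) else 0) • x := by
  induction hx using bidegree_induction with
  | zero p k => simp
  | one => simp [totalDeriv_one, lowerDeriv_one]
  | add p k x y _ _ hx hy => simp only [map_add, hx, hy, smul_add]; abel
  | smul p k c x _ hx => simp only [map_smul, hx, smul_add, smul_comm c]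
  | gen_mul v p k x _ hx =>
    simp only [totalDeriv_mul, lowerDeriv_mul, map_add, lowerDeriv_totalDeriv_gen, hx, add_mul,
      mul_add, smul_mul_assoc, mul_smul_comm]
    split_ifs
    · push_cast
      rw [add_smul]
      abel
    · simp only [zero_smul]
      abel

/-! ### Euler's formula and the homotopy identity -/

theorem sum_dx_mul_contraction_gen_mul (v : Var n I) (x : LocalForm n I) :
    ∑ μ, dx μ * contraction μ (gen v * x) =
      (formDeg v : ℝ) • (gen v * x) + gen v * ∑ μ, dx μ * contraction μ x := by
  rw [Finset.mul_sum]
  rcases v with v | (⟨a, s, M⟩ | ν)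
  · simp only [formDeg, Nat.cast_zero, zero_smul, zero_add]
    refine Finset.sum_congr rfl fun μ _ => ?_
    rw [contraction_inl_mul, ← mul_assoc, ← inl_mul_comm, mul_assoc]
  · simp only [formDeg, Nat.cast_zero, zero_smul, zero_add]
    refine Finset.sum_congr rfl fun μ _ => ?_
    rw [contraction_hStar_mul, ← mul_assoc, dx, inr_mul_inr (.hStar a s M)]
    refine (mul_neg (gen (.inr (.dx μ)) : LocalForm n I) _).trans ?_
    rw [← mul_assoc]
    exact (neg_mul (gen (.inr (.dx μ)) * gen (.inr (.hStar a s M)) : LocalForm n I) _).symm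
  · have h : ∀ μ, (dx μ : LocalForm n I) * contraction μ (gen (.inr (.dx ν)) * x) =
        (if μ = ν then gen (.inr (.dx ν)) * x else 0) +
          gen (.inr (.dx ν)) * (dx μ * contraction μ x) := by
      intro μ
      rw [contraction_dx_mul, mul_sub, sub_eq_iff_eq_add, add_assoc, ← mul_assoc, ← mul_assoc,
        ← add_mul, dx, inr_mul_inr (.dx ν), neg_add_cancel, zero_mul, add_zero]
      split_ifs with h
      · rw [h]
      · rw [mul_zero]
    rw [Finset.sum_congr rfl fun μ _ => h μ, Finset.sum_add_distrib]
    simp [formDeg]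

/-- Euler's formula for the form degree. -/
theorem sum_dx_mul_contraction {p k : ℤ} {x : LocalForm n I} (hx : x ∈ bidegree n I p k) :
    ∑ μ, dx μ * contraction μ x = (p : ℝ) • x := by
  induction hx using bidegree_induction with
  | zero p k => simp
  | one => simp [contraction_one]
  | add p k x y _ _ hx hy =>
    simp only [map_add, mul_add, Finset.sum_add_distrib, hx, hy, smul_add]
  | smul p k c x _ hx => simp only [map_smul, mul_smul_comm, ← Finset.smul_sum, hx, smul_comm c]
  | gen_mul v p k x _ hx =>
    rw [sum_dx_mul_contraction_gen_mul, hx, mul_smul_comm, ← add_smul, add_comm]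
    push_cast
    rfl

theorem extDeriv_apply (x : LocalForm n I) : extDeriv x = ∑ μ, dx μ * totalDeriv μ x := by
  simp [extDeriv]

theorem extDeriv_extDeriv (x : LocalForm n I) : extDeriv (extDeriv x) = 0 := by
  have h : extDeriv (extDeriv x) =
      ∑ μ, ∑ ν, dx μ * dx ν * totalDeriv μ (totalDeriv ν x) := by
    rw [extDeriv_apply]
    refine Finset.sum_congr rfl fun μ _ => ?_
    rw [extDeriv_apply, map_sum, Finset.mul_sum]
    refine Finset.sum_congr rfl fun ν _ => ?_
    rw [totalDeriv_mul, dx, dx, totalDeriv_dx, zero_mul, zero_add, mul_assoc]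
  -- Adding the sum to its copy with `μ` and `ν` exchanged pairs commuting derivatives with
  -- anticommuting one-forms.
  have h' : extDeriv (extDeriv x) + extDeriv (extDeriv x) = 0 := by
    conv_lhs => rw [h]; arg 1; rw [Finset.sum_comm]
    simp only [← Finset.sum_add_distrib]
    refine Finset.sum_eq_zero fun μ _ => Finset.sum_eq_zero fun ν _ => ?_
    rw [totalDeriv_comm, ← add_mul, dx, dx, inr_mul_inr, neg_add_cancel, zero_mul]
  rw [← two_smul ℝ] at h'
  exact (smul_eq_zero_iff_right two_ne_zero).mp h'

/-- The operator `∑_μ D_μ E_μ`, where `D_μ` is the total and `E_μ` the lowering derivative. -/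
def raiseLower : LocalForm n I →ₗ[ℝ] LocalForm n I :=
  ∑ μ : Fin n, totalDeriv μ ∘ₗ lowerDeriv μ

/-- The operator `∑_μ E_μ ∘ ∂/∂(dx^μ)`, a contracting homotopy for `d` up to triangular terms. -/
def homotopy : LocalForm n I →ₗ[ℝ] LocalForm n I :=
  ∑ μ : Fin n, lowerDeriv μ ∘ₗ contraction μ

theorem raiseLower_apply (x : LocalForm n I) :
    raiseLower x = ∑ μ, totalDeriv μ (lowerDeriv μ x) := by
  simp [raiseLower]

theorem homotopy_apply (x : LocalForm n I) :
    homotopy x = ∑ μ, lowerDeriv μ (contraction μ x) := by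
  simp [homotopy]

/-- Moving `E_μ` past `D_ν` leaves a central term only for `ν = μ`. Thus each lowering changes the
eigenvalue of `raiseLower` by `k`. -/
theorem lowerDeriv_raiseLower (μ : Fin n) {p k : ℤ} {x : LocalForm n I}
    (hx : x ∈ bidegree n I p k) :
    lowerDeriv μ (raiseLower x) = raiseLower (lowerDeriv μ x) + (k : ℝ) • lowerDeriv μ x := by
  simp only [raiseLower_apply, map_sum,
    lowerDeriv_totalDeriv μ _ (lowerDeriv_mem_bidegree _ hx), Finset.sum_add_distrib,
    lowerDeriv_comm μ]
  simp

/-- Moving the contraction past `dx` leaves `∑ E_μ D_μ` and cross terms (`h1`). The trace of the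
Heisenberg relation turns the former into `R + k n` (`h2`). The same relation and Euler's formula
turn the latter into `dH + k p` (`h3`). -/
theorem extDeriv_homotopy_add {p k : ℤ} {x : LocalForm n I} (hx : x ∈ bidegree n I p k) :
    extDeriv (homotopy x) + homotopy (extDeriv x) + ((k : ℝ) * p) • x =
      raiseLower x + ((k : ℝ) * n) • x := by
  have h1 : homotopy (extDeriv x) +
      ∑ ν, ∑ μ, dx ν * lowerDeriv μ (totalDeriv ν (contraction μ x)) =
        ∑ μ, lowerDeriv μ (totalDeriv μ x) := by
    rw [Finset.sum_comm, homotopy_apply, ← Finset.sum_add_distrib]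
    refine Finset.sum_congr rfl fun μ _ => ?_
    rw [extDeriv_apply, map_sum, map_sum, ← Finset.sum_add_distrib, Finset.sum_eq_single μ]
    · rw [dx, contraction_dx_mul, if_pos rfl, map_sub, lowerDeriv_mul, lowerDeriv_dx, zero_mul,
        zero_add, contraction_totalDeriv, sub_add_cancel]
    · intro ν _ hν
      rw [dx, contraction_dx_mul, if_neg hν.symm, map_sub, lowerDeriv_mul, lowerDeriv_dx, zero_mul,
        zero_add, contraction_totalDeriv, sub_add_cancel, map_zero]
    · simp
  have h2 : ∑ μ, lowerDeriv μ (totalDeriv μ x) = raiseLower x + ((k : ℝ) * n) • x := by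
    simp only [lowerDeriv_totalDeriv _ _ hx, Finset.sum_add_distrib, raiseLower_apply]
    simp [← Nat.cast_smul_eq_nsmul ℝ, smul_smul, mul_comm]
  have h3 : ∑ ν, ∑ μ, dx ν * lowerDeriv μ (totalDeriv ν (contraction μ x)) =
      extDeriv (homotopy x) + ((k : ℝ) * p) • x := by
    rw [mul_smul, ← sum_dx_mul_contraction hx, Finset.smul_sum, extDeriv_apply,
      ← Finset.sum_add_distrib]
    refine Finset.sum_congr rfl fun ν _ => ?_
    rw [homotopy_apply, map_sum, Finset.mul_sum]
    simp only [lowerDeriv_totalDeriv _ _ (contraction_mem_bidegree _ hx), mul_add,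
      Finset.sum_add_distrib]
    simp
    exact mul_smul_comm _ _ _
  rw [← h2, ← h1, h3]
  abel

/-! ### The filtration by nilpotency of the lowering derivations -/

/-- The increasing filtration by the number of lowering derivatives needed to annihilate. -/
def lowerFiltration (n : ℕ) (I : Type*) : ℕ → Submodule ℝ (LocalForm n I)
  | 0 => ⊥
  | m + 1 => ⨅ μ, (lowerFiltration n I m).comap (lowerDeriv μ)

theorem mem_lowerFiltration_succ {m : ℕ} {x : LocalForm n I} :
    x ∈ lowerFiltration n I (m + 1) ↔ ∀ μ, lowerDeriv μ x ∈ lowerFiltration n I m := by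
  simp [lowerFiltration]

theorem lowerFiltration_mono : Monotone (lowerFiltration n I) := by
  refine monotone_nat_of_le_succ fun m => ?_
  induction m with
  | zero => exact bot_le
  | succ m ih =>
    intro x hx
    exact mem_lowerFiltration_succ.mpr fun μ => ih (mem_lowerFiltration_succ.mp hx μ)

/-- By Leibniz each lowering hits one factor. The index `m + l` is one more than needed, which
avoids subtraction. -/
theorem mul_mem_lowerFiltration {m l : ℕ} {x y : LocalForm n I}
    (hx : x ∈ lowerFiltration n I m) (hy : y ∈ lowerFiltration n I l) :
    x * y ∈ lowerFiltration n I (m + l) := by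
  induction h : m + l generalizing m l x y with
  | zero =>
    obtain ⟨rfl, rfl⟩ : m = 0 ∧ l = 0 := by omega
    rw [(Submodule.mem_bot ℝ).mp hx, zero_mul]
    exact zero_mem _
  | succ j ih =>
    rcases m with - | m
    · rw [(Submodule.mem_bot ℝ).mp hx, zero_mul]
      exact zero_mem _
    rcases l with - | l
    · rw [(Submodule.mem_bot ℝ).mp hy, mul_zero]
      exact zero_mem _
    refine mem_lowerFiltration_succ.mpr fun μ => ?_
    rw [lowerDeriv_mul]
    exact add_mem (ih (mem_lowerFiltration_succ.mp hx μ) hy (by omega))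
      (ih hx (mem_lowerFiltration_succ.mp hy μ) (by omega))

theorem degree_sub_single_lt {M : Fin n →₀ ℕ} {μ : Fin n} (h : M μ ≠ 0) :
    (M - Finsupp.single μ 1).degree < M.degree := by
  have := congrArg Finsupp.degree
    (tsub_add_cancel_of_le (show Finsupp.single μ 1 ≤ M by simpa [Nat.one_le_iff_ne_zero] using h))
  rw [map_add, Finsupp.degree_single] at this
  omega

/-- Each lowering removes one derivative. The inequality is strict because level `0` is zero, so an
undifferentiated antifield first appears at level `1`. -/
theorem hStar_mem_lowerFiltration (a : I) (s : Sym2 (Fin n)) {m : ℕ} {M : Fin n →₀ ℕ}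
    (h : M.degree < m) : gen (.inr (.hStar a s M)) ∈ lowerFiltration n I m := by
  induction m generalizing M with
  | zero => omega
  | succ m ih =>
    refine mem_lowerFiltration_succ.mpr fun μ => ?_
    rw [lowerDeriv_hStar]
    by_cases h0 : M μ = 0
    · simp [h0]
    · exact Submodule.smul_mem _ _ (ih ((degree_sub_single_lt h0).trans_le (Nat.lt_succ_iff.mp h)))

theorem cStar_mem_lowerFiltration (a : I) (α : Fin n) {m : ℕ} {M : Fin n →₀ ℕ}
    (h : M.degree < m) : gen (.inl (.cStar a α M)) ∈ lowerFiltration n I m := by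
  induction m generalizing M with
  | zero => omega
  | succ m ih =>
    refine mem_lowerFiltration_succ.mpr fun μ => ?_
    rw [lowerDeriv_cStar]
    by_cases h0 : M μ = 0
    · simp [h0]
    · exact Submodule.smul_mem _ _ (ih ((degree_sub_single_lt h0).trans_le (Nat.lt_succ_iff.mp h)))

theorem exists_gen_mem_lowerFiltration (v : Var n I) : ∃ m, gen v ∈ lowerFiltration n I m := by
  rcases v with (⟨a, s, M⟩ | ⟨a, α, M⟩) | (⟨a, s, M⟩ | ρ)
  · exact ⟨1, mem_lowerFiltration_succ.mpr fun μ => by simp⟩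
  · exact ⟨_, cStar_mem_lowerFiltration a α (Nat.lt_succ_self _)⟩
  · exact ⟨_, hStar_mem_lowerFiltration a s (Nat.lt_succ_self _)⟩
  · exact ⟨1, mem_lowerFiltration_succ.mpr fun μ => by simp⟩

/-- The lowering derivatives are locally nilpotent. -/
theorem exists_mem_lowerFiltration (x : LocalForm n I) : ∃ m, x ∈ lowerFiltration n I m := by
  induction x using localForm_induction with
  | one => exact ⟨1, mem_lowerFiltration_succ.mpr fun μ => by simp [lowerDeriv_one]⟩
  | add x y hx hy =>
    obtain ⟨m, hx⟩ := hx
    obtain ⟨l, hy⟩ := hy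
    exact ⟨max m l, add_mem (lowerFiltration_mono (le_max_left m l) hx)
      (lowerFiltration_mono (le_max_right m l) hy)⟩
  | smul c x hx =>
    obtain ⟨m, hx⟩ := hx
    exact ⟨m, Submodule.smul_mem _ _ hx⟩
  | gen_mul v x hx =>
    obtain ⟨m, hx⟩ := hx
    obtain ⟨l, hv⟩ := exists_gen_mem_lowerFiltration v
    exact ⟨l + m, mul_mem_lowerFiltration hv hx⟩

/-- On the `m`-th graded piece of the filtration `raiseLower` acts as multiplication by `k m`. -/
theorem raiseLower_add_smul_mem {m : ℕ} {p k : ℤ} {x : LocalForm n I}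
    (hx : x ∈ bidegree n I p k) (hm : x ∈ lowerFiltration n I (m + 1)) :
    raiseLower x + (-((k : ℝ) * m)) • x ∈ lowerFiltration n I m := by
  induction m generalizing x with
  | zero =>
    have h : ∀ μ, lowerDeriv μ x = 0 := fun μ =>
      (Submodule.mem_bot ℝ).mp (mem_lowerFiltration_succ.mp hm μ)
    simp [raiseLower_apply, h]
  | succ m ih =>
    refine mem_lowerFiltration_succ.mpr fun μ => ?_
    have := ih (lowerDeriv_mem_bidegree μ hx) (mem_lowerFiltration_succ.mp hm μ)
    -- `E_μ (R - k (m + 1)) = (R - k m) E_μ`, so the induction hypothesis for `E_μ x` applies.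
    rw [map_add, map_smul, lowerDeriv_raiseLower μ hx, add_assoc, ← add_smul]
    convert this using 3
    push_cast
    ring

/-! ### Stability of the invariant polynomials -/

/-- The span of the jet coordinates of `h`. -/
def fieldSpan (n : ℕ) (I : Type*) : Submodule ℝ (LocalForm n I) :=
  Submodule.span ℝ {x | ∃ a s M, x = gen (.inl (.h a s M))}

theorem totalDeriv_mem_fieldSpan (μ : Fin n) {x : LocalForm n I} (hx : x ∈ fieldSpan n I) :
    totalDeriv μ x ∈ fieldSpan n I := by
  induction hx using Submodule.span_induction with
  | mem x h =>
    obtain ⟨a, s, M, rfl⟩ := h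
    exact Submodule.subset_span ⟨a, s, _, totalDeriv_gen_inl μ _⟩
  | zero => simp
  | add x y _ _ hx hy => rw [map_add]; exact add_mem hx hy
  | smul c x _ hx => rw [map_smul]; exact Submodule.smul_mem _ _ hx

theorem lowerDeriv_fieldSpan (μ : Fin n) {x : LocalForm n I} (hx : x ∈ fieldSpan n I) :
    lowerDeriv μ x = 0 := by
  induction hx using Submodule.span_induction with
  | mem x h =>
    obtain ⟨a, s, M, rfl⟩ := h
    exact lowerDeriv_h μ a s M
  | zero => simp
  | add x y _ _ hx hy => rw [map_add, hx, hy, add_zero]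
  | smul c x _ hx => rw [map_smul, hx, smul_zero]

theorem contraction_fieldSpan_mul (μ : Fin n) {x : LocalForm n I} (hx : x ∈ fieldSpan n I)
    (y : LocalForm n I) : contraction μ (x * y) = x * contraction μ y := by
  induction hx using Submodule.span_induction with
  | mem x h =>
    obtain ⟨a, s, M, rfl⟩ := h
    exact contraction_inl_mul μ _ y
  | zero => simp
  | add x y _ _ hx hy => rw [add_mul, map_add, hx, hy, add_mul]
  | smul c x _ hx => rw [smul_mul_assoc, map_smul, hx, smul_mul_assoc]

theorem curvature_mem_fieldSpan (a : I) (α β μ ν : Fin n) :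
    curvature a α β μ ν ∈ fieldSpan n I := by
  have h : ∀ ρ σ κ l : Fin n, ddh a ρ σ κ l ∈ fieldSpan n I := fun ρ σ κ l =>
    Submodule.subset_span ⟨a, _, _, rfl⟩
  exact Submodule.smul_mem _ _ (sub_mem (sub_mem (add_mem (h _ _ _ _) (h _ _ _ _)) (h _ _ _ _))
    (h _ _ _ _))

/-- Lowering and contraction treat every linear combination of jets of `h` alike, so the exact form
of the curvature may be forgotten. -/
theorem IsInvariantGenerator.classify {x : LocalForm n I} (hx : IsInvariantGenerator x) :
    x ∈ fieldSpan n I ∨ (∃ a s M, x = gen (.inr (.hStar a s M))) ∨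
      (∃ a α M, x = gen (.inl (.cStar a α M))) ∨ ∃ μ, x = gen (.inr (.dx μ)) := by
  induction hx with
  | curvature a α β μ ν => exact .inl (curvature_mem_fieldSpan a α β μ ν)
  | hStar a α β => exact .inr (.inl ⟨_, _, _, rfl⟩)
  | cStar a α => exact .inr (.inr (.inl ⟨_, _, _, rfl⟩))
  | dx μ => exact .inr (.inr (.inr ⟨μ, rfl⟩))
  | deriv μ x _ ih =>
    rcases ih with h | ⟨a, s, M, rfl⟩ | ⟨a, α, M, rfl⟩ | ⟨ν, rfl⟩
    · exact .inl (totalDeriv_mem_fieldSpan μ h)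
    · exact .inr (.inl ⟨_, _, _, totalDeriv_hStar ..⟩)
    · exact .inr (.inr (.inl ⟨_, _, _, totalDeriv_gen_inl ..⟩))
    -- The derivative of `dx^ν` is zero, which lies in `fieldSpan`.
    · exact .inl (by simp)

theorem multiIndex_induction {P : (Fin n →₀ ℕ) → Prop} (zero : P 0)
    (add_single : ∀ M μ, P M → P (M + Finsupp.single μ 1)) (M : Fin n →₀ ℕ) : P M := by
  induction h : M.degree using Nat.strong_induction_on generalizing M with
  | _ d ih =>
    by_cases hM : M = 0
    · exact hM ▸ zero
    · obtain ⟨μ, hμ⟩ := DFunLike.ne_iff.mp hM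
      have hle : Finsupp.single μ 1 ≤ M := by simpa [Nat.one_le_iff_ne_zero] using hμ
      rw [← tsub_add_cancel_of_le hle]
      exact add_single _ μ (ih _ (h ▸ degree_sub_single_lt hμ) _ rfl)

/-- Lowering a derivative of an antifield yields another of its jet coordinates, which has to be
recognised as invariant. -/
theorem isInvariantGenerator_hStar (a : I) (s : Sym2 (Fin n)) (M : Fin n →₀ ℕ) :
    IsInvariantGenerator (gen (.inr (.hStar a s M))) := by
  induction M using multiIndex_induction with
  | zero =>
    induction s with
    | _ α β => exact .hStar a α β
  | add_single M μ ih =>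
    rw [← totalDeriv_hStar]
    exact .deriv μ _ ih

theorem isInvariantGenerator_cStar (a : I) (α : Fin n) (M : Fin n →₀ ℕ) :
    IsInvariantGenerator (gen (.inl (.cStar a α M))) := by
  induction M using multiIndex_induction with
  | zero => exact .cStar a α
  | add_single M μ ih =>
    have := IsInvariantGenerator.deriv μ _ ih
    rwa [totalDeriv_gen_inl] at this

theorem IsInvariantGenerator.mem {x : LocalForm n I} (hx : IsInvariantGenerator x) :
    x ∈ invariantPolynomials n I := Algebra.subset_adjoin hx

theorem derivation_mem_invariantPolynomials {T : LocalForm n I →ₗ[ℝ] LocalForm n I}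
    (one : T 1 = 0) (mul : ∀ x y, T (x * y) = T x * y + x * T y)
    (gen' : ∀ x, IsInvariantGenerator x → T x ∈ invariantPolynomials n I)
    {x : LocalForm n I} (hx : x ∈ invariantPolynomials n I) : T x ∈ invariantPolynomials n I := by
  induction hx using Algebra.adjoin_induction with
  | mem x h => exact gen' x h
  | algebraMap r =>
    rw [Algebra.algebraMap_eq_smul_one, map_smul, one, smul_zero]
    exact zero_mem _
  | add x y _ _ hx hy => rw [map_add]; exact add_mem hx hy
  | mul x y hx hy hTx hTy => rw [mul]; exact add_mem (mul_mem hTx hy) (mul_mem hx hTy)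

theorem totalDeriv_mem_invariantPolynomials (μ : Fin n) {x : LocalForm n I}
    (hx : x ∈ invariantPolynomials n I) : totalDeriv μ x ∈ invariantPolynomials n I :=
  derivation_mem_invariantPolynomials (totalDeriv_one μ) (totalDeriv_mul μ)
    (fun x h => (IsInvariantGenerator.deriv μ x h).mem) hx

theorem lowerDeriv_mem_invariantPolynomials (μ : Fin n) {x : LocalForm n I}
    (hx : x ∈ invariantPolynomials n I) : lowerDeriv μ x ∈ invariantPolynomials n I := by
  refine derivation_mem_invariantPolynomials (lowerDeriv_one μ) (lowerDeriv_mul μ)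
    (fun x h => ?_) hx
  rcases h.classify with h | ⟨a, s, M, rfl⟩ | ⟨a, α, M, rfl⟩ | ⟨ν, rfl⟩
  · rw [lowerDeriv_fieldSpan μ h]
    exact zero_mem _
  · rw [lowerDeriv_hStar]
    exact Subalgebra.smul_mem _ (isInvariantGenerator_hStar a s _).mem _
  · rw [lowerDeriv_cStar]
    exact Subalgebra.smul_mem _ (isInvariantGenerator_cStar a α _).mem _
  · rw [lowerDeriv_dx]
    exact zero_mem _

theorem contraction_mem_invariantPolynomials (μ : Fin n) {x : LocalForm n I}
    (hx : x ∈ invariantPolynomials n I) : contraction μ x ∈ invariantPolynomials n I := by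
  -- Contraction obeys a product rule whose sign depends on the left factor. The claim is therefore
  -- strengthened to left multiplication, so that only generators need to be moved past it.
  suffices h : ∀ y ∈ invariantPolynomials n I, contraction μ y ∈ invariantPolynomials n I →
      contraction μ (x * y) ∈ invariantPolynomials n I by
    have := h 1 (one_mem _) (by rw [contraction_one]; exact zero_mem _)
    rwa [mul_one] at this
  induction hx using Algebra.adjoin_induction with
  | mem x h =>
    intro y hy hcy
    have hxy := mul_mem (IsInvariantGenerator.mem h) hcy
    rcases IsInvariantGenerator.classify h with h | ⟨a, s, M, rfl⟩ | ⟨a, α, M, rfl⟩ | ⟨ν, rfl⟩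
    · rwa [contraction_fieldSpan_mul μ h]
    · rw [contraction_hStar_mul]
      exact neg_mem hxy
    · rwa [contraction_inl_mul]
    · rw [contraction_dx_mul]
      refine sub_mem ?_ hxy
      split_ifs
      · exact hy
      · exact zero_mem _
  | algebraMap r =>
    intro y hy hcy
    rw [← Algebra.smul_def, map_smul]
    exact Subalgebra.smul_mem _ hcy _
  | add x x' _ _ hx hx' =>
    intro y hy hcy
    rw [add_mul, map_add]
    exact add_mem (hx y hy hcy) (hx' y hy hcy)
  | mul x x' hx hx' h h' =>
    intro y hy hcy
    rw [mul_assoc]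
    exact h _ (mul_mem hx' hy) (h' y hy hcy)

theorem homotopy_mem {p k : ℤ} {x : LocalForm n I} (hx : x ∈ invariantPolynomials n I)
    (hxd : x ∈ bidegree n I p k) :
    homotopy x ∈ invariantPolynomials n I ∧ homotopy x ∈ bidegree n I (p - 1) k := by
  rw [homotopy_apply]
  exact ⟨sum_mem fun μ _ =>
      lowerDeriv_mem_invariantPolynomials μ (contraction_mem_invariantPolynomials μ hx),
    sum_mem fun μ _ => lowerDeriv_mem_bidegree μ (contraction_mem_bidegree μ hxd)⟩

theorem raiseLower_mem {p k : ℤ} {x : LocalForm n I} (hx : x ∈ invariantPolynomials n I)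
    (hxd : x ∈ bidegree n I p k) :
    raiseLower x ∈ invariantPolynomials n I ∧ raiseLower x ∈ bidegree n I p k := by
  rw [raiseLower_apply]
  exact ⟨sum_mem fun μ _ =>
      totalDeriv_mem_invariantPolynomials μ (lowerDeriv_mem_invariantPolynomials μ hx),
    sum_mem fun μ _ => totalDeriv_mem_bidegree μ (lowerDeriv_mem_bidegree μ hxd)⟩

/-! ### Exactness by induction on the filtration -/

theorem exact_of_mem_lowerFiltration {p k : ℤ} (hp : p < n) (hk : 0 < k) {m : ℕ}
    {x : LocalForm n I} (hm : x ∈ lowerFiltration n I m) (hx : x ∈ invariantPolynomials n I)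
    (hxd : x ∈ bidegree n I p k) (hclosed : extDeriv x = 0) :
    ∃ β ∈ invariantPolynomials n I, β ∈ bidegree n I (p - 1) k ∧ extDeriv β = x := by
  induction m generalizing x with
  | zero =>
    refine ⟨0, zero_mem _, zero_mem _, ?_⟩
    rw [(Submodule.mem_bot ℝ).mp hm, map_zero]
  | succ m ih =>
    obtain ⟨hh, hhd⟩ := homotopy_mem hx hxd
    obtain ⟨hr, hrd⟩ := raiseLower_mem hx hxd
    -- The eigenvalue `k m` of `raiseLower` on the layer, plus `k (n - p)` from the homotopy
    -- identity.
    set c : ℝ := k * m + k * (n - p) with hc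
    have hc0 : c ≠ 0 := by
      have h1 : (0 : ℝ) < k := by exact_mod_cast hk
      have h2 : (0 : ℝ) < n - p := sub_pos.mpr (by exact_mod_cast hp)
      positivity
    have key : raiseLower x + (-((k : ℝ) * m)) • x + c • x = extDeriv (homotopy x) := by
      have h := extDeriv_homotopy_add hxd
      rw [hclosed, map_zero, add_zero] at h
      refine add_right_cancel (b := ((k : ℝ) * p) • x) ?_
      rw [h, add_assoc, add_assoc, ← add_smul, ← add_smul]
      congr 2
      rw [hc]
      ring
    have hy : extDeriv (raiseLower x + (-((k : ℝ) * m)) • x) = 0 := by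
      have := congrArg extDeriv key
      rwa [extDeriv_extDeriv, map_add _ _ (c • x), map_smul _ c, hclosed, smul_zero,
        add_zero] at this
    obtain ⟨β, hβ, hβd, hdβ⟩ := ih (raiseLower_add_smul_mem hxd hm)
      (add_mem hr (Subalgebra.smul_mem _ hx _)) (add_mem hrd (Submodule.smul_mem _ _ hxd)) hy
    -- By `key`, `d(Hx) = y + c x`, where the lower remainder `y` equals `dβ` by induction.
    refine ⟨c⁻¹ • (homotopy x - β), Subalgebra.smul_mem _ (sub_mem hh hβ) _,
      Submodule.smul_mem _ _ (sub_mem hhd hβd), ?_⟩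
    rw [map_smul, map_sub, hdβ, ← key, add_sub_cancel_left, smul_smul, inv_mul_cancel₀ hc0,
      one_smul]

end

end SpinTwo

theorem theorem3p1 (n : ℕ) (I : Type*) (p k : ℤ) (hp : p < n) (hk : 0 < k)
    (α : SpinTwo.LocalForm n I) (hα : α ∈ SpinTwo.invariantPolynomials n I)
    (hαd : α ∈ SpinTwo.bidegree n I p k) (hclosed : SpinTwo.extDeriv α = 0) :
    ∃ β ∈ SpinTwo.invariantPolynomials n I,
      β ∈ SpinTwo.bidegree n I (p - 1) k ∧ SpinTwo.extDeriv β = α := by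
  obtain ⟨m, hm⟩ := SpinTwo.exists_mem_lowerFiltration α
  exact SpinTwo.exact_of_mem_lowerFiltration hp hk hm hα hαd hclosed
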